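/- Let $L$ be a separable infinite-dimensional complex Hilbert space, $\mathcal B=\mathcal B(L)$ its bounded operators, $\mathcal K\subset\mathcal B$ the bounded finite rank operators, and fix a unitary $\iota$ from the Hilbert tensor square $L\mathbin{\dot\otimes}L$ onto $L$. For $a,b\in\mathcal B$ put $a\diamond b:=\iota(a\mathbin{\dot\otimes}b)\iota^{-1}\in\mathcal B$. For a complex linear space $E$ let $\mathcal KE:=\mathcal K\otimes E$ (algebraic tensor product; $ax:=a\otimes x$), a $\mathcal B$-bimodule via $a\cdot(cx)\cdot b:=(acb)x$. A PQ-norm on $E$ is a norm on $\mathcal KE$ with $\|a\cdot u\cdot b\|\le\|a\|\|u\|\|b\|$ for all $a,b\in\mathcal B$, $u\in\mathcal KE$; it is a Q-norm if moreover $\|P\cdot u\cdot P+Q\cdot v\cdot Q\|=\max\{\|P\cdot u\cdot P\|,\|Q\cdot v\cdot Q\|\}$ for all $u,v\in\mathcal KE$ and all orthogonal projections $P,Q\in\mathcal B$ with $PQ=0$. A space with a PQ-norm (Q-norm) is a PQ-space (Q-space). For PQ-spaces $E,F$ let $\diamond:\mathcal KE\times\mathcal KF\to\mathcal K(E\otimes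 F)$ be the bilinear map with $ax\diamond by=(a\diamond b)(x\otimes y)$, and for $U\in\mathcal K(E\otimes F)$ put $$\|U\|_{pop}:=\inf\Big\{\sum_{k}\|a_k\|\|u_k\|\|v_k\|\|b_k\|\Big\},\qquad \|U\|_{op}:=\inf\{\|a\|\|u\|\|v\|\|b\|\},$$ the first infimum over all finite representations $U=\sum_k a_k\cdot(u_k\diamond v_k)\cdot b_k$ with $a_k,b_k\in\mathcal B$, $u_k\in\mathcal KE$, $v_k\in\mathcal KF$, the second over all representations $U=a\cdot(u\diamond v)\cdot b$ with $a,b\in\mathcal K$, $u\in\mathcal KE$, $v\in\mathcal KF$. Let $^{(\infty)}\mathbb C$ be $\mathbb C$ with the operator norm on $\mathcal K\otimes\mathbb C=\mathcal K$, and let $\ell_1=L_1(\mathbb N,{}^{(\infty)}\mathbb C)$ be the space $\ell_1$ where $u=\sum_j a_jx_j\in\mathcal K\ell_1$ has the norm $\|u\|=\sum_{t\in\mathbb N}\big\|\sum_j x_j(t)a_j\big\|$. Let $e_k\in\ell_1$ be the sequence with $1$ in the $k$-th place and $0$ elsewhere. Then $\ell_1$ is a PQ-space but not a Q-space. For every $n\in\mathbb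 N$ and all rank one orthogonal projections $P_1,\dots,P_n$ with $P_jP_k=0$ for $j\ne k$, the elements $V_m:=\sum_{k=1}^mP_k(e_k\otimes e_k)\in\mathcal K(\ell_1\otimes\ell_1)$, $m\le n$, satisfy $$\|V_n\|_{pop}=n,\qquad\|V_n\|_{op}=n^2.$$ Moreover, for $1\le m<n$ we have $\|V_n-V_m\|_{op}=(n-m)^2$ and $\|V_m\|_{op}+\|V_n-V_m\|_{op}<\|V_n\|_{op}$. Consequently $\|\cdot\|_{op}$ on $\mathcal K(\ell_1\otimes\ell_1)$ is not a norm, and not even a seminorm. -/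

import Mathlib

open scoped TensorProduct

noncomputable section

namespace ProtoQuantum

/-! ### Finite rank operators and amplifications -/

section Amplification

variable (L : Type*) [NormedAddCommGroup L] [InnerProductSpace ℂ L]

/-- The space `𝓚` of bounded finite rank operators on `L`. -/
def finiteRank : Submodule ℂ (L →L[ℂ] L) where
  carrier := {a | FiniteDimensional ℂ (LinearMap.range (a : L →ₗ[ℂ] L))}
  zero_mem' := by
    have h : LinearMap.range ((0 : L →L[ℂ] L) : L →ₗ[ℂ] L) = ⊥ := by
      ext x; simp
    rw [Set.mem_ofPred_eq, h]
    infer_instance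
  add_mem' := by
    intro a b ha hb
    rw [Set.mem_ofPred_eq] at ha hb ⊢
    refine Submodule.finiteDimensional_of_le
      (S₂ := LinearMap.range (a : L →ₗ[ℂ] L) ⊔ LinearMap.range (b : L →ₗ[ℂ] L)) ?_
    rintro _ ⟨x, rfl⟩
    exact Submodule.add_mem_sup ⟨x, rfl⟩ ⟨x, rfl⟩
  smul_mem' := by
    intro c a ha
    rw [Set.mem_ofPred_eq] at ha ⊢
    refine Submodule.finiteDimensional_of_le (S₂ := LinearMap.range (a : L →ₗ[ℂ] L)) ?_
    rintro _ ⟨x, rfl⟩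
    exact ⟨c • x, by simp⟩

/-- The amplification `𝓚 ⊗ E` of a linear space `E`; the elementary tensor `a x` is `a ⊗ₜ x`. -/
abbrev Amp (E : Type*) [AddCommGroup E] [Module ℂ E] : Type _ := (finiteRank L) ⊗[ℂ] E

variable {L}

/-- The map `c ↦ a c b` on finite rank operators. -/
def sandwich (a b : L →L[ℂ] L) : finiteRank L →ₗ[ℂ] finiteRank L where
  toFun c := ⟨a * (c : L →L[ℂ] L) * b, by
    have hc : FiniteDimensional ℂ (LinearMap.range ((c : L →L[ℂ] L) : L →ₗ[ℂ] L)) := c.2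
    change FiniteDimensional ℂ
      (LinearMap.range ((a * (c : L →L[ℂ] L) * b : L →L[ℂ] L) : L →ₗ[ℂ] L))
    refine Submodule.finiteDimensional_of_le
      (S₂ := (LinearMap.range ((c : L →L[ℂ] L) : L →ₗ[ℂ] L)).map (a : L →ₗ[ℂ] L)) ?_
    rintro _ ⟨x, rfl⟩
    exact ⟨(c : L →L[ℂ] L) (b x), ⟨b x, rfl⟩, rfl⟩⟩
  map_add' c d := by ext x; simp
  map_smul' r c := by ext x; simp

/-- The two-sided action `a · u · b` of the bounded operators on the amplification `𝓚 ⊗ E`,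
given on elementary tensors by `a · (c x) · b = (a c b) x`. -/
def bimul {E : Type*} [AddCommGroup E] [Module ℂ E] (a b : L →L[ℂ] L) :
    Amp L E →ₗ[ℂ] Amp L E :=
  (sandwich a b).rTensor E

/-! ### Proto-quantum norms and quantum norms -/

/-- `N` is a proto-quantum norm on `E`: a norm on the amplification `𝓚 ⊗ E` that makes it a
contractive bimodule over the algebra of bounded operators. -/
structure IsPQNorm {E : Type*} [AddCommGroup E] [Module ℂ E] (N : Amp L E → ℝ) : Prop where
  add_le : ∀ u v, N (u + v) ≤ N u + N v
  smul : ∀ (c : ℂ) u, N (c • u) = ‖c‖ * N u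
  eq_zero : ∀ u, N u = 0 → u = 0
  contractive : ∀ (a b : L →L[ℂ] L) u, N (bimul a b u) ≤ ‖a‖ * N u * ‖b‖

/-- `N` is a quantum norm on `E`: a proto-quantum norm such that
`‖P·u·P + Q·v·Q‖ = max (‖P·u·P‖, ‖Q·v·Q‖)` for orthogonal projections with `PQ = 0`. -/
structure IsQNorm [CompleteSpace L] {E : Type*} [AddCommGroup E] [Module ℂ E]
    (N : Amp L E → ℝ) : Prop extends IsPQNorm N where
  max_eq : ∀ P Q : L →L[ℂ] L, IsStarProjection P → IsStarProjection Q → P * Q = 0 →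
    ∀ u v, N (bimul P P u + bimul Q Q v) = max (N (bimul P P u)) (N (bimul Q Q v))

end Amplification

/-! ### The diamond operation -/

section Diamond

variable {L : Type*} [NormedAddCommGroup L] [InnerProductSpace ℂ L]

/-- The operator `a ⋄ b = ι (a ⊗ b) ι⁻¹` on `L`, where `ι` identifies the Hilbert tensor square of
`L` (the completion of `L ⊗ L`) with `L`, and `a ⊗ b` is the Hilbert tensor product of operators. -/
def diamondOp (ι : UniformSpace.Completion (L ⊗[ℂ] L) ≃ₗᵢ[ℂ] L) (a b : L →L[ℂ] L) : L →L[ℂ] L :=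
  (ι.toContinuousLinearEquiv : UniformSpace.Completion (L ⊗[ℂ] L) →L[ℂ] L) ∘L
    (TensorProduct.mapL a b).completion ∘L
    (ι.symm.toContinuousLinearEquiv : L →L[ℂ] UniformSpace.Completion (L ⊗[ℂ] L))

theorem diamondOp_apply (ι : UniformSpace.Completion (L ⊗[ℂ] L) ≃ₗᵢ[ℂ] L) (a b : L →L[ℂ] L)
    (ξ η : L) :
    diamondOp ι a b (ι ((ξ ⊗ₜ[ℂ] η : L ⊗[ℂ] L) : UniformSpace.Completion (L ⊗[ℂ] L))) =
      ι ((a ξ ⊗ₜ[ℂ] b η : L ⊗[ℂ] L) : UniformSpace.Completion (L ⊗[ℂ] L)) := by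
  simp [diamondOp]

theorem diamondOp_ext (ι : UniformSpace.Completion (L ⊗[ℂ] L) ≃ₗᵢ[ℂ] L) {c d : L →L[ℂ] L}
    (h : ∀ ξ η : L,
      c (ι ((ξ ⊗ₜ[ℂ] η : L ⊗[ℂ] L) : UniformSpace.Completion (L ⊗[ℂ] L))) =
        d (ι ((ξ ⊗ₜ[ℂ] η : L ⊗[ℂ] L) : UniformSpace.Completion (L ⊗[ℂ] L)))) : c = d := by
  have key : ∀ z : UniformSpace.Completion (L ⊗[ℂ] L), c (ι z) = d (ι z) := by
    intro z
    refine UniformSpace.Completion.induction_on z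
      (isClosed_eq (c.continuous.comp ι.continuous) (d.continuous.comp ι.continuous)) ?_
    intro w
    induction w using TensorProduct.induction_on with
    | zero => rw [UniformSpace.Completion.coe_zero, map_zero, map_zero, map_zero]
    | tmul x y => exact h x y
    | add x y hx hy => simp [UniformSpace.Completion.coe_add, hx, hy]
  ext x
  simpa using key (ι.symm x)

theorem diamondOp_mem (ι : UniformSpace.Completion (L ⊗[ℂ] L) ≃ₗᵢ[ℂ] L) {a b : L →L[ℂ] L}
    (ha : a ∈ finiteRank L) (hb : b ∈ finiteRank L) : diamondOp ι a b ∈ finiteRank L := by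
  have ha' : FiniteDimensional ℂ (LinearMap.range (a : L →ₗ[ℂ] L)) := ha
  have hb' : FiniteDimensional ℂ (LinearMap.range (b : L →ₗ[ℂ] L)) := hb
  let J : L ⊗[ℂ] L →ₗ[ℂ] L :=
    (ι.toLinearEquiv : UniformSpace.Completion (L ⊗[ℂ] L) →ₗ[ℂ] L) ∘ₗ
      (UniformSpace.Completion.toComplL (𝕜 := ℂ) (E := L ⊗[ℂ] L) :
        L ⊗[ℂ] L →ₗ[ℂ] UniformSpace.Completion (L ⊗[ℂ] L))
  let S : Submodule ℂ L := (LinearMap.range (TensorProduct.mapIncl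
    (LinearMap.range (a : L →ₗ[ℂ] L)) (LinearMap.range (b : L →ₗ[ℂ] L)))).map J
  have hS : FiniteDimensional ℂ S := inferInstance
  have hclosed : IsClosed (S : Set L) := Submodule.closed_of_finiteDimensional S
  have key : ∀ z : UniformSpace.Completion (L ⊗[ℂ] L), diamondOp ι a b (ι z) ∈ S := by
    intro z
    refine UniformSpace.Completion.induction_on z
      (hclosed.preimage ((diamondOp ι a b).continuous.comp ι.continuous)) ?_
    intro w
    induction w using TensorProduct.induction_on with
    | zero =>
      rw [UniformSpace.Completion.coe_zero, map_zero, map_zero]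
      exact S.zero_mem
    | tmul x y =>
      rw [diamondOp_apply]
      exact ⟨a x ⊗ₜ b y, ⟨⟨a x, x, rfl⟩ ⊗ₜ ⟨b y, y, rfl⟩, by simp⟩, rfl⟩
    | add x y hx hy =>
      rw [UniformSpace.Completion.coe_add, map_add, map_add]
      exact S.add_mem hx hy
  change FiniteDimensional ℂ (LinearMap.range ((diamondOp ι a b : L →L[ℂ] L) : L →ₗ[ℂ] L))
  refine Submodule.finiteDimensional_of_le (S₂ := S) ?_
  rintro _ ⟨x, rfl⟩
  simpa using key (ι.symm x)

/-- The diamond operation as a bilinear map on finite rank operators. -/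
def diamond (ι : UniformSpace.Completion (L ⊗[ℂ] L) ≃ₗᵢ[ℂ] L) :
    finiteRank L →ₗ[ℂ] finiteRank L →ₗ[ℂ] finiteRank L :=
  LinearMap.mk₂ ℂ (fun a b => ⟨diamondOp ι a b, diamondOp_mem ι a.2 b.2⟩)
    (fun a a' b => Subtype.ext <| diamondOp_ext ι fun ξ η => by
      simp [diamondOp_apply, TensorProduct.add_tmul, UniformSpace.Completion.coe_add])
    (fun r a b => Subtype.ext <| diamondOp_ext ι fun ξ η => by
      simp [diamondOp_apply, ← TensorProduct.smul_tmul', UniformSpace.Completion.coe_smul])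
    (fun a b b' => Subtype.ext <| diamondOp_ext ι fun ξ η => by
      simp [diamondOp_apply, TensorProduct.tmul_add, UniformSpace.Completion.coe_add])
    (fun r a b => Subtype.ext <| diamondOp_ext ι fun ξ η => by
      simp [diamondOp_apply, TensorProduct.tmul_smul, UniformSpace.Completion.coe_smul])

/-- The operation `u ⋄ v` on amplifications, given on elementary tensors by
`(a x) ⋄ (b y) = (a ⋄ b) (x ⊗ y)`. -/
def ampDiamond (ι : UniformSpace.Completion (L ⊗[ℂ] L) ≃ₗᵢ[ℂ] L)
    (E F : Type*) [AddCommGroup E] [Module ℂ E] [AddCommGroup F] [Module ℂ F] :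
    Amp L E →ₗ[ℂ] Amp L F →ₗ[ℂ] Amp L (E ⊗[ℂ] F) :=
  TensorProduct.map₂ (diamond ι) (TensorProduct.mk ℂ E F)

/-! ### The two tensor (semi-)norms -/

variable {E F : Type*} [AddCommGroup E] [Module ℂ E] [AddCommGroup F] [Module ℂ F]

/-- The proto-operator-projective norm: the infimum of `∑ ‖aₖ‖ ‖uₖ‖ ‖vₖ‖ ‖bₖ‖` over all
representations `U = ∑ aₖ · (uₖ ⋄ vₖ) · bₖ` with `aₖ, bₖ` bounded operators. -/
def popNorm (ι : UniformSpace.Completion (L ⊗[ℂ] L) ≃ₗᵢ[ℂ] L)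
    (NE : Amp L E → ℝ) (NF : Amp L F → ℝ) (U : Amp L (E ⊗[ℂ] F)) : ℝ :=
  sInf {r : ℝ | ∃ (n : ℕ) (a b : Fin n → (L →L[ℂ] L)) (u : Fin n → Amp L E) (v : Fin n → Amp L F),
    U = ∑ k, bimul (a k) (b k) (ampDiamond ι E F (u k) (v k)) ∧
    r = ∑ k, ‖a k‖ * NE (u k) * NF (v k) * ‖b k‖}

/-- The number given by the operator-projective formula: the infimum of `‖a‖ ‖u‖ ‖v‖ ‖b‖` over all
representations `U = a · (u ⋄ v) · b` with `a, b` of finite rank. -/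
def opNorm (ι : UniformSpace.Completion (L ⊗[ℂ] L) ≃ₗᵢ[ℂ] L)
    (NE : Amp L E → ℝ) (NF : Amp L F → ℝ) (U : Amp L (E ⊗[ℂ] F)) : ℝ :=
  sInf {r : ℝ | ∃ (a b : finiteRank L) (u : Amp L E) (v : Amp L F),
    U = bimul (a : L →L[ℂ] L) (b : L →L[ℂ] L) (ampDiamond ι E F u v) ∧
    r = ‖(a : L →L[ℂ] L)‖ * NE u * NF v * ‖(b : L →L[ℂ] L)‖}

end Diamond

/-! ### The space `ℓ₁ = L₁(ℕ, ^{(∞)}ℂ)` -/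

section LOne

variable {L : Type*} [NormedAddCommGroup L] [InnerProductSpace ℂ L]

/-- The norm of the proto-quantization `^{(∞)}E` of a normed space `E`: the projective tensor norm
on `𝓚 ⊗ E`, where `𝓚` carries the operator norm. -/
def infQuantNorm {E : Type*} [NormedAddCommGroup E] [NormedSpace ℂ E] (u : Amp L E) : ℝ :=
  sInf {r : ℝ | ∃ (n : ℕ) (a : Fin n → finiteRank L) (x : Fin n → E),
    u = ∑ k, a k ⊗ₜ[ℂ] x k ∧ r = ∑ k, ‖(a k : L →L[ℂ] L)‖ * ‖x k‖}

open MeasureTheory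

variable {X : Type*} [MeasurableSpace X] (μ : Measure X) (p : ENNReal)
  {F : Type*} [NormedAddCommGroup F] [NormedSpace ℂ F]

/-- The map taking `u ∈ 𝓚 ⊗ L_p(X, F)` to a `𝓚 ⊗ F`-valued function on `X` (up to equality almost
everywhere), given on elementary tensors by `a x ↦ (t ↦ a (x t))`. -/
def ampEval : Amp L (Lp F p μ) →ₗ[ℂ] Filter.Germ (ae μ) (Amp L F) :=
  TensorProduct.lift <| LinearMap.mk₂ ℂ
    (fun (a : finiteRank L) (x : Lp F p μ) =>
      ((fun t => a ⊗ₜ[ℂ] x t : X → Amp L F) : Filter.Germ (ae μ) (Amp L F)))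
    (fun a a' x => Filter.Germ.coe_eq.2 <| Filter.Eventually.of_forall fun t => by
      simp [TensorProduct.add_tmul])
    (fun c a x => Filter.Germ.coe_eq.2 <| Filter.Eventually.of_forall fun t => by
      simp [TensorProduct.smul_tmul'])
    (fun a x y => Filter.Germ.coe_eq.2 <| by
      filter_upwards [Lp.coeFn_add x y] with t ht
      rw [ht, Pi.add_apply, TensorProduct.tmul_add])
    (fun c a x => Filter.Germ.coe_eq.2 <| by
      filter_upwards [Lp.coeFn_smul c x] with t ht
      rw [ht, Pi.smul_apply, TensorProduct.tmul_smul]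
      rfl)

/-- The proto-quantum norm of `L_p(X, F)`, where `N` is the proto-quantum norm of `F` (and the norm
of `F` is the one of the underlying space): the `L_p`-norm of the function `t ↦ ‖u(t)‖`, where
`u(t) ∈ 𝓚 ⊗ F`. -/
def lpAmpNorm (N : Amp L F → ℝ) (u : Amp L (Lp F p μ)) : ℝ :=
  Filter.Germ.liftOn (ampEval μ p u) (fun f => (eLpNorm (fun t => N (f t)) p μ).toReal)
    (fun f g (h : f =ᵐ[μ] g) => congrArg ENNReal.toReal <| eLpNorm_congr_ae <| by
      filter_upwards [h] with t ht
      rw [ht])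

/-- The linear space `ℓ₁`, that is, `L₁(ℕ, ℂ)` for the counting measure on `ℕ`. -/
abbrev ell1 : Type := Lp ℂ 1 (Measure.count : Measure ℕ)

/-- The proto-quantum norm of `ℓ₁ = L₁(ℕ, ^{(∞)}ℂ)`. -/
def ell1Norm : Amp L ell1 → ℝ :=
  lpAmpNorm (Measure.count : Measure ℕ) 1 (infQuantNorm (L := L) (E := ℂ))

/-- The sequence `e_k ∈ ℓ₁` with `1` as the `k`-th coordinate and `0` elsewhere. -/
def ell1Basis (k : ℕ) : ell1 :=
  indicatorConstLp 1 (MeasurableSet.singleton k) (by simp) (1 : ℂ)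

end LOne

/-- The element `V_n = ∑_{k=1}^n P_k (e_k ⊗ e_k)`. -/
def V {L : Type*} [NormedAddCommGroup L] [InnerProductSpace ℂ L] (P : ℕ → finiteRank L) (n : ℕ) :
    Amp L (ell1 ⊗[ℂ] ell1) :=
  ∑ k ∈ Finset.Icc 1 n, P k ⊗ₜ[ℂ] (ell1Basis k ⊗ₜ[ℂ] ell1Basis k)

end ProtoQuantum

end

noncomputable section

namespace ProtoQuantum

open MeasureTheory

variable {L : Type*} [NormedAddCommGroup L] [InnerProductSpace ℂ L]

/-! ### Coordinates of elements of `𝓚 ⊗ ℓ₁` -/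

/-! Everything is read off from coordinates. The norm on `𝓚 ⊗ ℓ₁` is `∑ ‖u(t)‖`, and the `(t,
t)`-coordinate of `a · (u ⋄ v) · b` is `a (u(t) ⋄ v(t)) b`, of norm at most `‖a‖ ‖u(t)‖ ‖v(t)‖ ‖b‖`
(`norm_coord₂_le`). The diagonal coordinates of `V_n` are the `P_t`, of norm one.

If a single term represents `V_n`, the same `u` and `v` must serve all `n` coordinates at once, and
Cauchy–Schwarz gives a cost of at least `n²` (`card_sq_le_of_one_le_norm_coord₂`). If sums are
allowed, `∑ xₜ yₜ ≤ (∑ xₜ) (∑ yₜ)` bounds the diagonal mass of each term by its cost, and the total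
is at least `n` (`card_le_popNorm_repr`).

Both bounds are attained. Let `P_k` project onto the unit vector `f_k`, and let `u = ∑ P_k e_k`, of
norm `n`. The partial isometry `f_k ⊗ f_k ↦ f_k` and its adjoint compress `u ⋄ u` to `V_n` at cost
`n²` (`diagElem_eq_bimul_ampDiamond`). The same construction applied to each index separately costs
one per index, hence `n`. Subadditivity then fails because `m² + (n - m)² < n²`. -/

theorem infQuantNorm_complex (u : Amp L ℂ) :
    infQuantNorm u = ‖((TensorProduct.rid ℂ (finiteRank L) u : finiteRank L) : L →L[ℂ] L)‖ := by
  have hrep : u = TensorProduct.rid ℂ (finiteRank L) u ⊗ₜ[ℂ] (1 : ℂ) := by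
    rw [← TensorProduct.rid_symm_apply, LinearEquiv.symm_apply_apply]
  have hmem : ‖((TensorProduct.rid ℂ (finiteRank L) u : finiteRank L) : L →L[ℂ] L)‖ ∈
      {r : ℝ | ∃ (n : ℕ) (a : Fin n → finiteRank L) (x : Fin n → ℂ),
        u = ∑ k, a k ⊗ₜ[ℂ] x k ∧ r = ∑ k, ‖(a k : L →L[ℂ] L)‖ * ‖x k‖} :=
    ⟨1, fun _ => TensorProduct.rid ℂ (finiteRank L) u, fun _ => 1, by simpa using hrep, by simp⟩
  have hlb : ∀ r ∈ {r : ℝ | ∃ (n : ℕ) (a : Fin n → finiteRank L) (x : Fin n → ℂ),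
        u = ∑ k, a k ⊗ₜ[ℂ] x k ∧ r = ∑ k, ‖(a k : L →L[ℂ] L)‖ * ‖x k‖},
      ‖((TensorProduct.rid ℂ (finiteRank L) u : finiteRank L) : L →L[ℂ] L)‖ ≤ r := by
    rintro r ⟨n, a, x, rfl, rfl⟩
    rw [← LinearEquiv.coe_toLinearMap, map_sum, Submodule.coe_sum]
    simp only [LinearEquiv.coe_toLinearMap, TensorProduct.rid_tmul, Submodule.coe_smul]
    refine (norm_sum_le _ _).trans (Finset.sum_le_sum fun k _ => ?_)
    rw [norm_smul, mul_comm]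
  exact le_antisymm (csInf_le ⟨_, hlb⟩ hmem) (le_csInf ⟨_, hmem⟩ hlb)

/-- The `t`-th coordinate functional on `ℓ₁`. -/
def ell1Coord (t : ℕ) : ell1 →ₗ[ℂ] ℂ where
  toFun x := x t
  -- Only the empty set is null for the counting measure, so almost everywhere identities hold at
  -- every point.
  map_add' x y := Measure.ae_count_iff.1 (Lp.coeFn_add x y) t
  map_smul' c x := Measure.ae_count_iff.1 (Lp.coeFn_smul c x) t

theorem ell1Coord_basis (t k : ℕ) : ell1Coord t (ell1Basis k) = if t = k then 1 else 0 := by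
  have h := Measure.ae_count_iff.1 (indicatorConstLp_coeFn (μ := (Measure.count : Measure ℕ))
    (p := 1) (hs := MeasurableSet.singleton k) (hμs := by simp) (c := (1 : ℂ))) t
  exact h.trans (by simp [Set.indicator_apply])

theorem ell1_ext {x y : ell1} (h : ∀ t, ell1Coord t x = ell1Coord t y) : x = y :=
  Lp.ext (Filter.Eventually.of_forall h)

theorem summable_ell1Coord (x : ell1) : Summable fun t => ‖ell1Coord t x‖ := by
  have h : Integrable x Measure.count := L1.integrable_coeFn x
  exact integrable_count_iff.1 h

/-- The `t`-th coordinate `u(t)` of `u ∈ 𝓚 ⊗ ℓ₁`. -/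
def coord (t : ℕ) : Amp L ell1 →ₗ[ℂ] finiteRank L :=
  (TensorProduct.rid ℂ (finiteRank L)).toLinearMap ∘ₗ (ell1Coord t).lTensor (finiteRank L)

@[simp]
theorem coord_tmul (t : ℕ) (a : finiteRank L) (x : ell1) :
    coord t (a ⊗ₜ[ℂ] x) = ell1Coord t x • a := by
  simp [coord]

theorem coord_bimul (t : ℕ) (a b : L →L[ℂ] L) (u : Amp L ell1) :
    coord t (bimul a b u) = sandwich a b (coord t u) := by
  induction u using TensorProduct.induction_on with
  | zero => simp
  | tmul c x => simp [bimul]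
  | add u v hu hv => simp [hu, hv]

/-- Expand `u = ∑ Bᵢ ⊗ cᵢ` along a basis of `𝓚`: the `t`-th coordinate is `∑ cᵢ(t) Bᵢ`, so linear
independence kills every `cᵢ(t)`. This yields definiteness of the norm. -/
theorem eq_zero_of_coord_eq_zero {u : Amp L ell1} (h : ∀ t, coord t u = 0) : u = 0 := by
  let B := Module.Basis.ofVectorSpace ℂ (finiteRank L)
  obtain ⟨c, rfl⟩ := TensorProduct.eq_repr_basis_left B u
  suffices hc : c = 0 by simp [hc]
  ext1 i
  refine ell1_ext fun t => ?_
  have ht := h t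
  simp only [Finsupp.sum, map_sum, coord_tmul] at ht
  by_cases hi : i ∈ c.support
  · simpa using linearIndependent_iff'.1 B.linearIndependent _ _ ht i hi
  · simp [Finsupp.notMem_support_iff.1 hi]

/-- Needed because `tsum` takes the default value `0` on families that are not summable. -/
theorem summable_coord (u : Amp L ell1) : Summable fun t => ‖(coord t u : L →L[ℂ] L)‖ := by
  induction u using TensorProduct.induction_on with
  | zero => simp
  | tmul a x => simpa [norm_smul] using (summable_ell1Coord x).mul_right ‖(a : L →L[ℂ] L)‖
  | add u v hu hv =>
    refine (hu.add hv).of_nonneg_of_le (fun _ => norm_nonneg _) fun t => ?_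
    rw [map_add]
    exact norm_add_le (coord t u : L →L[ℂ] L) (coord t v : L →L[ℂ] L)

theorem ampEval_ell1 (u : Amp L ell1) :
    ampEval (Measure.count : Measure ℕ) 1 u =
      ((fun t => (ell1Coord t).lTensor (finiteRank L) u : ℕ → Amp L ℂ) :
        Filter.Germ (ae (Measure.count : Measure ℕ)) (Amp L ℂ)) := by
  induction u using TensorProduct.induction_on with
  | zero => simp only [map_zero]; rfl
  | tmul a x => rfl
  | add u v hu hv =>
    rw [map_add, hu, hv]
    simp only [map_add]
    rfl

/-- All later facts about this norm rest on this formula; the measure-theoretic definition is not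
unfolded again. -/
theorem ell1Norm_eq_tsum (u : Amp L ell1) :
    ell1Norm u = ∑' t, ‖(coord t u : L →L[ℂ] L)‖ := by
  have h : ell1Norm u = (eLpNorm (fun t => infQuantNorm ((ell1Coord t).lTensor (finiteRank L) u))
      1 (Measure.count : Measure ℕ)).toReal := by
    rw [ell1Norm, lpAmpNorm, ampEval_ell1]
    rfl
  rw [h, eLpNorm_one_eq_lintegral_enorm, lintegral_count, ENNReal.tsum_toReal_eq (by simp)]
  refine tsum_congr fun t => ?_
  rw [infQuantNorm_complex, toReal_enorm, norm_norm]
  rfl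

theorem ell1Norm_nonneg (u : Amp L ell1) : 0 ≤ ell1Norm u := by
  rw [ell1Norm_eq_tsum]
  exact tsum_nonneg fun _ => norm_nonneg _

theorem sum_coord_le_ell1Norm (A : Finset ℕ) (u : Amp L ell1) :
    ∑ t ∈ A, ‖(coord t u : L →L[ℂ] L)‖ ≤ ell1Norm u := by
  rw [ell1Norm_eq_tsum]
  exact (summable_coord u).sum_le_tsum _ fun _ _ => norm_nonneg _

theorem coord_sum_tmul_basis (t : ℕ) (A : Finset ℕ) (p : ℕ → finiteRank L) :
    coord t (∑ k ∈ A, p k ⊗ₜ[ℂ] ell1Basis k) = if t ∈ A then p t else 0 := by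
  simp [ell1Coord_basis]

theorem ell1Norm_sum_tmul_basis (A : Finset ℕ) (p : ℕ → finiteRank L) :
    ell1Norm (∑ k ∈ A, p k ⊗ₜ[ℂ] ell1Basis k) = ∑ k ∈ A, ‖(p k : L →L[ℂ] L)‖ := by
  rw [ell1Norm_eq_tsum, tsum_eq_sum (s := A)]
  · exact Finset.sum_congr rfl fun k hk => by rw [coord_sum_tmul_basis, if_pos hk]
  · intro k hk
    rw [coord_sum_tmul_basis, if_neg hk]
    simp

theorem isPQNorm_ell1Norm : IsPQNorm (ell1Norm (L := L)) where
  add_le u v := by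
    simp only [ell1Norm_eq_tsum]
    rw [← (summable_coord u).tsum_add (summable_coord v)]
    refine (summable_coord _).tsum_le_tsum (fun t => ?_)
      ((summable_coord u).add (summable_coord v))
    rw [map_add]
    exact norm_add_le (coord t u : L →L[ℂ] L) (coord t v : L →L[ℂ] L)
  smul c u := by
    simp only [ell1Norm_eq_tsum, map_smul, Submodule.coe_smul, norm_smul, tsum_mul_left]
  eq_zero u h := by
    rw [ell1Norm_eq_tsum] at h
    refine eq_zero_of_coord_eq_zero fun t => Subtype.ext (norm_eq_zero.1 ?_)
    refine le_antisymm ?_ (norm_nonneg _)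
    rw [← h]
    exact (summable_coord u).le_tsum t fun _ _ => norm_nonneg _
  contractive a b u := by
    simp only [ell1Norm_eq_tsum, ← tsum_mul_left, ← tsum_mul_right]
    refine (summable_coord _).tsum_le_tsum (fun t => ?_)
      (((summable_coord u).mul_left _).mul_right _)
    rw [coord_bimul]
    exact (norm_mul_le _ _).trans (mul_le_mul_of_nonneg_right (norm_mul_le _ _) (norm_nonneg _))

/-! ### Rank one operators -/

/-- The operator `x ↦ ⟨g, x⟩ f` as an element of `𝓚`. -/
def rankOneFin (f g : L) : finiteRank L :=
  ⟨InnerProductSpace.rankOne ℂ f g, by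
    change FiniteDimensional ℂ
      (LinearMap.range ((InnerProductSpace.rankOne ℂ f g : L →L[ℂ] L) : L →ₗ[ℂ] L))
    refine Submodule.finiteDimensional_of_le (S₂ := Submodule.span ℂ {f}) ?_
    rintro _ ⟨x, rfl⟩
    exact Submodule.mem_span_singleton.2 ⟨inner ℂ g x, by simp⟩⟩

@[simp]
theorem coe_rankOneFin (f g : L) :
    (rankOneFin f g : L →L[ℂ] L) = InnerProductSpace.rankOne ℂ f g := rfl

/-- Normalise a spanning vector of the range to a unit vector `f`. Then `p f = f`, self-adjointness
gives `⟨f, x⟩ = ⟨f, p x⟩`, and `p x` is a multiple of `f`. -/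
theorem eq_rankOne_of_finrank_range_eq_one [CompleteSpace L] {p : L →L[ℂ] L}
    (hp : IsStarProjection p)
    (hr : Module.finrank ℂ (LinearMap.range (p : L →ₗ[ℂ] L)) = 1) :
    ∃ f : L, ‖f‖ = 1 ∧ p = InnerProductSpace.rankOne ℂ f f := by
  obtain ⟨_, hproj⟩ := isStarProjection_iff_eq_starProjection_range.1 hp
  obtain ⟨v, hv, hspan⟩ := finrank_eq_one_iff'.1 hr
  have hv0 : (v : L) ≠ 0 := fun h => hv (Subtype.ext h)
  obtain ⟨w, hw⟩ : ∃ w, p w = v := v.2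
  let f : L := ((‖(v : L)‖⁻¹ : ℝ) : ℂ) • (v : L)
  have hf : ‖f‖ = 1 := by
    simp [f, norm_smul, hv0]
  have hpf : p f = f := by
    have h2 : p (v : L) = v := by
      rw [← hw]
      exact congrArg (fun q : L →L[ℂ] L => q w) hp.isIdempotentElem
    simp [f, h2]
  refine ⟨f, hf, ?_⟩
  ext x
  obtain ⟨c, hc⟩ := hspan ⟨p x, x, rfl⟩
  have hc' : p x = (c * ‖(v : L)‖) • f := by
    have : p x = c • (v : L) := (congrArg Subtype.val hc).symm
    rw [this, smul_smul]
    congr 1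
    have : ((‖(v : L)‖ : ℝ) : ℂ) ≠ 0 := by simpa using hv0
    push_cast
    field_simp
  have hsym : inner ℂ f x = inner ℂ f (p x) := by
    have := hp.isSelfAdjoint.isSymmetric f x
    simp only [ContinuousLinearMap.coe_coe] at this
    rw [← this, hpf]
  rw [InnerProductSpace.rankOne_apply, hsym, hc', inner_smul_right, inner_self_eq_norm_sq_to_K, hf]
  simp

theorem exists_orthonormal_of_not_finiteDimensional (hL : ¬ FiniteDimensional ℂ L) :
    ∃ f g : L, ‖f‖ = 1 ∧ ‖g‖ = 1 ∧ inner ℂ f g = 0 := by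
  have hnorm : ∀ x : L, x ≠ 0 → ‖((‖x‖⁻¹ : ℝ) : ℂ) • x‖ = 1 := by
    intro x hx
    simp [norm_smul, hx]
  have hne : ∃ x : L, x ≠ 0 := by
    by_contra! h
    have : Subsingleton L := ⟨fun x y => by rw [h x, h y]⟩
    exact hL inferInstance
  obtain ⟨x, hx⟩ := hne
  have hbot : (Submodule.span ℂ {x})ᗮ ≠ ⊥ := by
    intro h
    rw [Submodule.orthogonal_eq_bot_iff] at h
    refine hL (Module.finite_def.2 ?_)
    rw [← h]
    exact Submodule.fg_span_singleton x
  obtain ⟨y, hy, hy0⟩ := Submodule.exists_mem_ne_zero_of_ne_bot hbot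
  refine ⟨_, _, hnorm x hx, hnorm y hy0, ?_⟩
  rw [inner_smul_left, inner_smul_right, Submodule.mem_orthogonal_singleton_iff_inner_right.1 hy]
  simp

/-- Two orthogonal rank one projections placed at different coordinates have norms that add up to 2,
while the quantum norm axiom would give the maximum 1. -/
theorem not_isQNorm_ell1Norm [CompleteSpace L] (hL : ¬ FiniteDimensional ℂ L) :
    ¬ IsQNorm (ell1Norm (L := L)) := by
  intro h
  obtain ⟨f, g, hf, hg, hfg⟩ := exists_orthonormal_of_not_finiteDimensional hL
  have key (f : L) (hf : ‖f‖ = 1) (k : ℕ) :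
      bimul (InnerProductSpace.rankOne ℂ f f) (InnerProductSpace.rankOne ℂ f f)
        (rankOneFin f f ⊗ₜ[ℂ] ell1Basis k) = rankOneFin f f ⊗ₜ[ℂ] ell1Basis k := by
    have : sandwich (InnerProductSpace.rankOne ℂ f f) (InnerProductSpace.rankOne ℂ f f)
        (rankOneFin f f) = rankOneFin f f := by
      refine Subtype.ext ?_
      change InnerProductSpace.rankOne ℂ f f * InnerProductSpace.rankOne ℂ f f *
        InnerProductSpace.rankOne ℂ f f = InnerProductSpace.rankOne ℂ f f
      have hi : InnerProductSpace.rankOne ℂ f f * InnerProductSpace.rankOne ℂ f f =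
        InnerProductSpace.rankOne ℂ f f := InnerProductSpace.isIdempotentElem_rankOne_self hf
      rw [hi, hi]
    simp [bimul, this]
  have hmul : InnerProductSpace.rankOne ℂ f f * InnerProductSpace.rankOne ℂ g g = 0 := by
    ext x
    simp [hfg]
  have hmax := h.max_eq _ _ (InnerProductSpace.isStarProjection_rankOne_self hf)
    (InnerProductSpace.isStarProjection_rankOne_self hg) hmul
    (rankOneFin f f ⊗ₜ ell1Basis 0) (rankOneFin g g ⊗ₜ ell1Basis 1)
  rw [key f hf, key g hg] at hmax
  let p : ℕ → finiteRank L := fun k => if k = 0 then rankOneFin f f else rankOneFin g g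
  have h0 := ell1Norm_sum_tmul_basis {0} p
  have h1 := ell1Norm_sum_tmul_basis {1} p
  have h01 := ell1Norm_sum_tmul_basis {0, 1} p
  simp [p, hf, hg] at h0 h1 h01
  rw [h0, h1, h01] at hmax
  norm_num at hmax


/-! ### The diamond operation on operators and on `𝓚 ⊗ ℓ₁` -/

/-- The bound on the algebraic tensor product passes to the completion by density, and `ι` is
isometric. -/
theorem norm_diamondOp_le (ι : UniformSpace.Completion (L ⊗[ℂ] L) ≃ₗᵢ[ℂ] L) (a b : L →L[ℂ] L) :
    ‖diamondOp ι a b‖ ≤ ‖a‖ * ‖b‖ := by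
  have hc : ∀ z : UniformSpace.Completion (L ⊗[ℂ] L),
      ‖(TensorProduct.mapL a b).completion z‖ ≤ ‖a‖ * ‖b‖ * ‖z‖ := by
    intro z
    refine UniformSpace.Completion.induction_on z
      (isClosed_le ((TensorProduct.mapL a b).completion.continuous.norm)
        (continuous_const.mul continuous_norm)) fun w => ?_
    rw [ContinuousLinearMap.completion_apply_coe, UniformSpace.Completion.norm_coe,
      UniformSpace.Completion.norm_coe]
    exact (TensorProduct.mapL a b).le_of_opNorm_le (TensorProduct.norm_mapL_le a b) w
  refine ContinuousLinearMap.opNorm_le_bound _ (by positivity) fun x => ?_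
  have h := hc (ι.symm x)
  rw [ι.symm.norm_map] at h
  refine le_trans (le_of_eq ?_) h
  exact ι.norm_map _

/-- The vector `ι (ξ ⊗ η)` of `L`. -/
def vecDiamond (ι : UniformSpace.Completion (L ⊗[ℂ] L) ≃ₗᵢ[ℂ] L) (ξ η : L) : L :=
  ι ((ξ ⊗ₜ[ℂ] η : L ⊗[ℂ] L) : UniformSpace.Completion (L ⊗[ℂ] L))

theorem inner_vecDiamond (ι : UniformSpace.Completion (L ⊗[ℂ] L) ≃ₗᵢ[ℂ] L) (ξ η ξ' η' : L) :
    inner ℂ (vecDiamond ι ξ η) (vecDiamond ι ξ' η') = inner ℂ ξ ξ' * inner ℂ η η' := by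
  rw [vecDiamond, vecDiamond, ι.inner_map_map, UniformSpace.Completion.inner_coe,
    TensorProduct.inner_tmul]

theorem diamondOp_rankOne (ι : UniformSpace.Completion (L ⊗[ℂ] L) ≃ₗᵢ[ℂ] L) (f g f' g' : L) :
    diamondOp ι (InnerProductSpace.rankOne ℂ f g) (InnerProductSpace.rankOne ℂ f' g') =
      InnerProductSpace.rankOne ℂ (vecDiamond ι f f') (vecDiamond ι g g') := by
  refine diamondOp_ext ι fun ξ η => ?_
  rw [diamondOp_apply]
  change _ = inner ℂ (vecDiamond ι g g') (vecDiamond ι ξ η) • vecDiamond ι f f'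
  rw [inner_vecDiamond, vecDiamond, InnerProductSpace.rankOne_apply,
    InnerProductSpace.rankOne_apply, TensorProduct.tmul_smul, ← TensorProduct.smul_tmul',
    smul_smul, UniformSpace.Completion.coe_smul, map_smul, mul_comm]

/-- The `(s, t)`-th coordinate of `U ∈ 𝓚 ⊗ (ℓ₁ ⊗ ℓ₁)`. -/
def coord₂ (s t : ℕ) : Amp L (ell1 ⊗[ℂ] ell1) →ₗ[ℂ] finiteRank L :=
  (TensorProduct.rid ℂ (finiteRank L)).toLinearMap ∘ₗ
    (TensorProduct.lift ((LinearMap.mul ℂ ℂ).compl₁₂ (ell1Coord s) (ell1Coord t))).lTensor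
      (finiteRank L)

@[simp]
theorem coord₂_tmul (s t : ℕ) (a : finiteRank L) (x y : ell1) :
    coord₂ s t (a ⊗ₜ[ℂ] (x ⊗ₜ[ℂ] y)) = (ell1Coord s x * ell1Coord t y) • a := by
  simp [coord₂]

theorem coord₂_bimul (s t : ℕ) (a b : L →L[ℂ] L) (U : Amp L (ell1 ⊗[ℂ] ell1)) :
    coord₂ s t (bimul a b U) = sandwich a b (coord₂ s t U) := by
  induction U using TensorProduct.induction_on with
  | zero => simp
  | tmul c x => simp [bimul, coord₂]
  | add u v hu hv => simp [hu, hv]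

theorem coord₂_ampDiamond (ι : UniformSpace.Completion (L ⊗[ℂ] L) ≃ₗᵢ[ℂ] L) (s t : ℕ)
    (u v : Amp L ell1) :
    coord₂ s t (ampDiamond ι ell1 ell1 u v) = diamond ι (coord s u) (coord t v) := by
  induction u using TensorProduct.induction_on with
  | zero => simp
  | add u u' hu hu' => simp [hu, hu']
  | tmul a x =>
    induction v using TensorProduct.induction_on with
    | zero => simp
    | add v v' hv hv' => simp only [map_add, hv, hv']
    | tmul b y => simp [ampDiamond, smul_smul, mul_comm]

theorem norm_coord₂_le (ι : UniformSpace.Completion (L ⊗[ℂ] L) ≃ₗᵢ[ℂ] L) (s t : ℕ)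
    (a b : L →L[ℂ] L) (u v : Amp L ell1) :
    ‖(coord₂ s t (bimul a b (ampDiamond ι ell1 ell1 u v)) : L →L[ℂ] L)‖ ≤
      ‖a‖ * ‖(coord s u : L →L[ℂ] L)‖ * ‖(coord t v : L →L[ℂ] L)‖ * ‖b‖ := by
  rw [coord₂_bimul, coord₂_ampDiamond]
  calc ‖a * diamondOp ι (coord s u) (coord t v) * b‖
      ≤ ‖a‖ * ‖diamondOp ι (coord s u) (coord t v)‖ * ‖b‖ :=
        (norm_mul_le _ _).trans (mul_le_mul_of_nonneg_right (norm_mul_le _ _) (norm_nonneg _))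
    _ ≤ ‖a‖ * (‖(coord s u : L →L[ℂ] L)‖ * ‖(coord t v : L →L[ℂ] L)‖) * ‖b‖ := by
        gcongr
        exact norm_diamondOp_le ι _ _
    _ = _ := by ring

/-! ### Diagonal elements of `𝓚 ⊗ (ℓ₁ ⊗ ℓ₁)` -/

/-- The element `∑_{k ∈ A} p_k (e_k ⊗ e_k)`. -/
def diagElem (p : ℕ → finiteRank L) (A : Finset ℕ) : Amp L (ell1 ⊗[ℂ] ell1) :=
  ∑ k ∈ A, p k ⊗ₜ[ℂ] (ell1Basis k ⊗ₜ[ℂ] ell1Basis k)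

theorem coord₂_diagElem (p : ℕ → finiteRank L) (A : Finset ℕ) {t : ℕ} (ht : t ∈ A) :
    coord₂ t t (diagElem p A) = p t := by
  simp [diagElem, ell1Coord_basis, ht]

/-- One term of a representation carries no more diagonal mass than its cost, since `∑ xₜ yₜ ≤ (∑
xₜ) (∑ yₜ)` for nonnegative numbers. -/
theorem sum_norm_coord₂_le (ι : UniformSpace.Completion (L ⊗[ℂ] L) ≃ₗᵢ[ℂ] L) (A : Finset ℕ)
    (a b : L →L[ℂ] L) (u v : Amp L ell1) :
    ∑ t ∈ A, ‖(coord₂ t t (bimul a b (ampDiamond ι ell1 ell1 u v)) : L →L[ℂ] L)‖ ≤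
      ‖a‖ * ell1Norm u * ell1Norm v * ‖b‖ := by
  calc _ ≤ ∑ t ∈ A, ‖a‖ * ‖b‖ * (‖(coord t u : L →L[ℂ] L)‖ * ‖(coord t v : L →L[ℂ] L)‖) := by
        refine Finset.sum_le_sum fun t _ => (norm_coord₂_le ι t t a b u v).trans (le_of_eq ?_)
        ring
    _ = ‖a‖ * ‖b‖ * ∑ t ∈ A, ‖(coord t u : L →L[ℂ] L)‖ * ‖(coord t v : L →L[ℂ] L)‖ := by
        rw [Finset.mul_sum]
    _ ≤ ‖a‖ * ‖b‖ * ((∑ t ∈ A, ‖(coord t u : L →L[ℂ] L)‖) *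
          ∑ t ∈ A, ‖(coord t v : L →L[ℂ] L)‖) := by
        gcongr
        rw [Finset.sum_mul]
        refine Finset.sum_le_sum fun t ht => mul_le_mul_of_nonneg_left ?_ (norm_nonneg _)
        exact Finset.single_le_sum (f := fun t => ‖(coord t v : L →L[ℂ] L)‖)
          (fun _ _ => norm_nonneg _) ht
    _ ≤ ‖a‖ * ‖b‖ * (ell1Norm u * ell1Norm v) := by
        gcongr
        · exact ell1Norm_nonneg u
        · exact sum_coord_le_ell1Norm A u
        · exact sum_coord_le_ell1Norm A v
    _ = _ := by ring

theorem card_sq_le_of_one_le_norm_coord₂ (ι : UniformSpace.Completion (L ⊗[ℂ] L) ≃ₗᵢ[ℂ] L)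
    (A : Finset ℕ) (a b : L →L[ℂ] L) (u v : Amp L ell1)
    (h : ∀ t ∈ A,
      1 ≤ ‖(coord₂ t t (bimul a b (ampDiamond ι ell1 ell1 u v)) : L →L[ℂ] L)‖) :
    (A.card : ℝ) ^ 2 ≤ ‖a‖ * ell1Norm u * ell1Norm v * ‖b‖ := by
  have hC : 0 ≤ ‖a‖ * ‖b‖ := by positivity
  -- Cauchy–Schwarz with the constant `‖a‖ ‖b‖` absorbed into the first family, so that its
  -- pointwise hypothesis is exactly the coordinate estimate.
  have hcs := Finset.sum_sq_le_sum_mul_sum_of_sq_le_mul A (r := fun _ => (1 : ℝ))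
    (f := fun t => ‖a‖ * ‖b‖ * ‖(coord t u : L →L[ℂ] L)‖)
    (g := fun t => ‖(coord t v : L →L[ℂ] L)‖)
    (fun t _ => by positivity) (fun t _ => norm_nonneg _)
    (fun t ht => by
      have h1 := (h t ht).trans (norm_coord₂_le ι t t a b u v)
      linarith)
  rw [← Finset.mul_sum] at hcs
  simp only [Finset.sum_const, nsmul_eq_mul, mul_one] at hcs
  calc _ ≤ _ := hcs
    _ ≤ ‖a‖ * ‖b‖ * ell1Norm u * ell1Norm v := by
        gcongr
        · exact mul_nonneg hC (ell1Norm_nonneg u)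
        · exact sum_coord_le_ell1Norm A u
        · exact sum_coord_le_ell1Norm A v
    _ = _ := by ring

theorem card_le_popNorm_repr (ι : UniformSpace.Completion (L ⊗[ℂ] L) ≃ₗᵢ[ℂ] L)
    (p : ℕ → finiteRank L) (A : Finset ℕ) (hp : ∀ t ∈ A, 1 ≤ ‖(p t : L →L[ℂ] L)‖)
    {n : ℕ} (a b : Fin n → (L →L[ℂ] L)) (u v : Fin n → Amp L ell1)
    (h : diagElem p A = ∑ k, bimul (a k) (b k) (ampDiamond ι ell1 ell1 (u k) (v k))) :
    (A.card : ℝ) ≤ ∑ k, ‖a k‖ * ell1Norm (u k) * ell1Norm (v k) * ‖b k‖ := by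
  calc (A.card : ℝ) = ∑ _t ∈ A, 1 := by simp
    _ ≤ ∑ t ∈ A, ‖(coord₂ t t (diagElem p A) : L →L[ℂ] L)‖ :=
        Finset.sum_le_sum fun t ht => by rw [coord₂_diagElem p A ht]; exact hp t ht
    _ ≤ ∑ t ∈ A, ∑ k, ‖(coord₂ t t
          (bimul (a k) (b k) (ampDiamond ι ell1 ell1 (u k) (v k))) : L →L[ℂ] L)‖ := by
        refine Finset.sum_le_sum fun t _ => ?_
        rw [h, map_sum, Submodule.coe_sum]
        exact norm_sum_le _ _
    _ = ∑ k, ∑ t ∈ A, ‖(coord₂ t t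
          (bimul (a k) (b k) (ampDiamond ι ell1 ell1 (u k) (v k))) : L →L[ℂ] L)‖ :=
        Finset.sum_comm
    _ ≤ _ := Finset.sum_le_sum fun k _ => sum_norm_coord₂_le ι A _ _ _ _

/-! ### Partial isometries between orthonormal families -/

/-- The operator `∑_{k ∈ A} ⟨g_k, ·⟩ f_k`. -/
def sumRankOne (A : Finset ℕ) (f g : ℕ → L) : finiteRank L :=
  ∑ k ∈ A, rankOneFin (f k) (g k)

theorem sumRankOne_apply (A : Finset ℕ) (f g : ℕ → L) (x : L) :
    (sumRankOne A f g : L →L[ℂ] L) x = ∑ k ∈ A, inner ℂ (g k) x • f k := by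
  simp [sumRankOne]

/-- Pythagoras for `f`, then Bessel for `g`: `‖∑ ⟨g_k, x⟩ f_k‖² = ∑ |⟨g_k, x⟩|² ≤ ‖x‖²`. -/
theorem norm_sumRankOne_le (A : Finset ℕ) {f g : ℕ → L}
    (hf : Orthonormal ℂ fun k : A => f k) (hg : Orthonormal ℂ fun k : A => g k) :
    ‖(sumRankOne A f g : L →L[ℂ] L)‖ ≤ 1 := by
  refine ContinuousLinearMap.opNorm_le_bound _ zero_le_one fun x => ?_
  rw [one_mul]
  refine le_of_sq_le_sq ?_ (norm_nonneg x)
  have hB := hg.sum_inner_products_le x (s := Finset.univ)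
  refine le_trans (le_of_eq ?_) hB
  rw [sumRankOne_apply, ← Finset.sum_coe_sort A fun k => inner ℂ (g k) x • f k]
  have h := hf.inner_sum (fun k => inner ℂ (g k) x) (fun k => inner ℂ (g k) x) Finset.univ
  rw [inner_self_eq_norm_sq_to_K] at h
  simp only [RCLike.conj_mul] at h
  exact_mod_cast h

theorem sandwich_rankOneFin [CompleteSpace L] (a b : L →L[ℂ] L) (f g : L) :
    sandwich a b (rankOneFin f g) = rankOneFin (a f) (ContinuousLinearMap.adjoint b g) := by
  refine Subtype.ext ?_
  ext x
  change a (inner ℂ g (b x) • f) = inner ℂ (ContinuousLinearMap.adjoint b g) x • a f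
  rw [map_smul, ContinuousLinearMap.adjoint_inner_left]

theorem adjoint_sumRankOne [CompleteSpace L] (A : Finset ℕ) (f g : ℕ → L) :
    ContinuousLinearMap.adjoint (sumRankOne A f g : L →L[ℂ] L) = sumRankOne A g f := by
  simp [sumRankOne, map_sum]

theorem sumRankOne_vecDiamond (ι : UniformSpace.Completion (L ⊗[ℂ] L) ≃ₗᵢ[ℂ] L) (A : Finset ℕ)
    {f : ℕ → L} (hf : Orthonormal ℂ fun k : A => f k) {i j : ℕ} (hi : i ∈ A) (hj : j ∈ A) :
    (sumRankOne A f fun k => vecDiamond ι (f k) (f k) : L →L[ℂ] L) (vecDiamond ι (f i) (f j)) =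
      if i = j then f i else 0 := by
  have hin : ∀ k ∈ A, ∀ l ∈ A, inner ℂ (f k) (f l) = if k = l then (1 : ℂ) else 0 := by
    intro k hk l hl
    simpa using orthonormal_iff_ite.1 hf ⟨k, hk⟩ ⟨l, hl⟩
  rw [sumRankOne_apply]
  have : ∀ k ∈ A, inner ℂ (vecDiamond ι (f k) (f k)) (vecDiamond ι (f i) (f j)) • f k =
      if k = i then (if i = j then f i else 0) else 0 := by
    intro k hk
    rw [inner_vecDiamond, hin k hk i hi, hin k hk j hj]
    split_ifs <;> simp_all
  rw [Finset.sum_congr rfl this]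
  simp [hi]

theorem orthonormal_vecDiamond (ι : UniformSpace.Completion (L ⊗[ℂ] L) ≃ₗᵢ[ℂ] L) {A : Finset ℕ}
    {f : ℕ → L} (hf : Orthonormal ℂ fun k : A => f k) :
    Orthonormal ℂ fun k : A => vecDiamond ι (f k) (f k) := by
  rw [orthonormal_iff_ite] at hf ⊢
  intro i j
  rw [inner_vecDiamond, hf i j]
  split_ifs <;> simp

theorem ampDiamond_rankOne_tmul (ι : UniformSpace.Completion (L ⊗[ℂ] L) ≃ₗᵢ[ℂ] L) (f g : L)
    (x y : ell1) :
    ampDiamond ι ell1 ell1 (rankOneFin f f ⊗ₜ[ℂ] x) (rankOneFin g g ⊗ₜ[ℂ] y) =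
      rankOneFin (vecDiamond ι f g) (vecDiamond ι f g) ⊗ₜ[ℂ] (x ⊗ₜ[ℂ] y) := by
  have : diamond ι (rankOneFin f f) (rankOneFin g g) =
      rankOneFin (vecDiamond ι f g) (vecDiamond ι f g) :=
    Subtype.ext (diamondOp_rankOne ι f f g g)
  simp [ampDiamond, this]

/-- The product `u ⋄ u` is a double sum over `(i, j)` of projections onto `f_i ⊗ f_j`. The partial
isometry annihilates the vectors with `i ≠ j` and sends `f_j ⊗ f_j` to `f_j`; its adjoint does the
same on the right. -/
theorem diagElem_eq_bimul_ampDiamond [CompleteSpace L]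
    (ι : UniformSpace.Completion (L ⊗[ℂ] L) ≃ₗᵢ[ℂ] L) (A : Finset ℕ) {f : ℕ → L}
    (hf : Orthonormal ℂ fun k : A => f k) :
    diagElem (fun k => rankOneFin (f k) (f k)) A =
      bimul (sumRankOne A f fun k => vecDiamond ι (f k) (f k) : L →L[ℂ] L)
        (sumRankOne A (fun k => vecDiamond ι (f k) (f k)) f : L →L[ℂ] L)
        (ampDiamond ι ell1 ell1 (∑ k ∈ A, rankOneFin (f k) (f k) ⊗ₜ[ℂ] ell1Basis k)
          (∑ k ∈ A, rankOneFin (f k) (f k) ⊗ₜ[ℂ] ell1Basis k)) := by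
  simp only [map_sum, LinearMap.sum_apply, ampDiamond_rankOne_tmul, diagElem]
  -- The outer index belongs to the second factor; for fixed `j` only `i = j` survives in the inner
  -- sum.
  refine Finset.sum_congr rfl fun j hj => ?_
  have h : ∀ i ∈ A, bimul (sumRankOne A f fun k => vecDiamond ι (f k) (f k) : L →L[ℂ] L)
      (sumRankOne A (fun k => vecDiamond ι (f k) (f k)) f : L →L[ℂ] L)
      (rankOneFin (vecDiamond ι (f i) (f j)) (vecDiamond ι (f i) (f j)) ⊗ₜ[ℂ]
        (ell1Basis i ⊗ₜ[ℂ] ell1Basis j)) =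
      if i = j then rankOneFin (f j) (f j) ⊗ₜ[ℂ] (ell1Basis j ⊗ₜ[ℂ] ell1Basis j) else 0 := by
    intro i hi
    rw [bimul, LinearMap.rTensor_tmul, sandwich_rankOneFin, adjoint_sumRankOne,
      sumRankOne_vecDiamond ι A hf hi hj]
    split_ifs with hij
    · rw [hij]
    · have : rankOneFin (0 : L) 0 = 0 := Subtype.ext (by simp)
      rw [this, TensorProduct.zero_tmul]
  rw [Finset.sum_congr rfl h]
  simp [hj]


/-! ### The two numbers for diagonal elements -/

theorem norm_rankOneFin_self {A : Finset ℕ} {f : ℕ → L} (hf : Orthonormal ℂ fun k : A => f k)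
    {k : ℕ} (hk : k ∈ A) : ‖(rankOneFin (f k) (f k) : L →L[ℂ] L)‖ = 1 := by
  have : ‖f k‖ = 1 := hf.1 ⟨k, hk⟩
  simp [this]

theorem ell1Norm_sum_rankOneFin {A : Finset ℕ} {f : ℕ → L}
    (hf : Orthonormal ℂ fun k : A => f k) :
    ell1Norm (∑ k ∈ A, rankOneFin (f k) (f k) ⊗ₜ[ℂ] ell1Basis k) = A.card := by
  rw [ell1Norm_sum_tmul_basis A fun k => rankOneFin (f k) (f k),
    Finset.sum_congr rfl fun k hk => norm_rankOneFin_self hf hk]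
  simp

theorem norm_mul_card_le {A : Finset ℕ} {f g : ℕ → L} (hf : Orthonormal ℂ fun k : A => f k)
    (hg : Orthonormal ℂ fun k : A => g k) :
    ‖(sumRankOne A f g : L →L[ℂ] L)‖ *
        ell1Norm (∑ k ∈ A, rankOneFin (f k) (f k) ⊗ₜ[ℂ] ell1Basis k) *
        ell1Norm (∑ k ∈ A, rankOneFin (f k) (f k) ⊗ₜ[ℂ] ell1Basis k) *
        ‖(sumRankOne A g f : L →L[ℂ] L)‖ ≤ (A.card : ℝ) ^ 2 := by
  rw [ell1Norm_sum_rankOneFin hf]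
  calc _ ≤ 1 * (A.card : ℝ) * A.card * 1 := by
        gcongr
        · exact norm_sumRankOne_le A hf hg
        · exact norm_sumRankOne_le A hg hf
    _ = _ := by ring

theorem diagElem_congr {A : Finset ℕ} {p q : ℕ → finiteRank L} (h : ∀ k ∈ A, p k = q k) :
    diagElem p A = diagElem q A :=
  Finset.sum_congr rfl fun k hk => by rw [h k hk]

theorem V_sub_V (P : ℕ → finiteRank L) {m n : ℕ} (h : m ≤ n) :
    V P n - V P m = diagElem P (Finset.Ioc m n) := by
  rw [sub_eq_iff_eq_add', V, V, diagElem, ← Finset.sum_union]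
  · refine Finset.sum_congr ?_ fun _ _ => rfl
    ext k
    simp only [Finset.mem_Icc, Finset.mem_union, Finset.mem_Ioc]
    omega
  · refine Finset.disjoint_left.2 fun k hk hk' => ?_
    simp only [Finset.mem_Icc, Finset.mem_Ioc] at hk hk'
    omega

theorem V_add_sub_cancel (P : ℕ → finiteRank L) (m n : ℕ) :
    V P m + (V P n - V P m) = V P n :=
  add_sub_cancel _ _

theorem finrank_range_rankOne {f : L} (hf : ‖f‖ = 1) :
    Module.finrank ℂ
      (LinearMap.range ((InnerProductSpace.rankOne ℂ f f : L →L[ℂ] L) : L →ₗ[ℂ] L)) = 1 := by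
  have h0 : f ≠ 0 := by
    rintro rfl
    simp at hf
  have : LinearMap.range ((InnerProductSpace.rankOne ℂ f f : L →L[ℂ] L) : L →ₗ[ℂ] L) =
      Submodule.span ℂ {f} := by
    refine le_antisymm ?_ ((Submodule.span_singleton_le_iff_mem _ _).2 ⟨f, by simp [hf]⟩)
    rintro _ ⟨x, rfl⟩
    exact Submodule.mem_span_singleton.2 ⟨inner ℂ f x, by simp⟩
  rw [this, finrank_span_singleton h0]

variable [CompleteSpace L]

/-- The infimum is attained: the compressing partial isometries are of finite rank, hence
admissible, and their cost meets the Cauchy–Schwarz bound. -/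
theorem opNorm_diagElem (ι : UniformSpace.Completion (L ⊗[ℂ] L) ≃ₗᵢ[ℂ] L) (A : Finset ℕ)
    {f : ℕ → L} (hf : Orthonormal ℂ fun k : A => f k) :
    opNorm ι ell1Norm ell1Norm (diagElem (fun k => rankOneFin (f k) (f k)) A) =
      (A.card : ℝ) ^ 2 := by
  set S := {r : ℝ | ∃ (a b : finiteRank L) (u : Amp L ell1) (v : Amp L ell1),
    diagElem (fun k => rankOneFin (f k) (f k)) A =
      bimul (a : L →L[ℂ] L) (b : L →L[ℂ] L) (ampDiamond ι ell1 ell1 u v) ∧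
    r = ‖(a : L →L[ℂ] L)‖ * ell1Norm u * ell1Norm v * ‖(b : L →L[ℂ] L)‖}
  have hlb : ∀ r ∈ S, (A.card : ℝ) ^ 2 ≤ r := by
    rintro r ⟨a, b, u, v, hU, rfl⟩
    refine card_sq_le_of_one_le_norm_coord₂ ι A _ _ _ _ fun t ht => ?_
    rw [← hU, coord₂_diagElem _ _ ht, norm_rankOneFin_self hf ht]
  have hmem := (⟨_, _, _, _, diagElem_eq_bimul_ampDiamond ι A hf, rfl⟩ : _ ∈ S)
  exact le_antisymm
    ((csInf_le ⟨_, hlb⟩ hmem).trans (norm_mul_card_le hf (orthonormal_vecDiamond ι hf)))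
    (le_csInf ⟨_, hmem⟩ hlb)

theorem popNorm_diagElem (ι : UniformSpace.Completion (L ⊗[ℂ] L) ≃ₗᵢ[ℂ] L) (A : Finset ℕ)
    {f : ℕ → L} (hf : Orthonormal ℂ fun k : A => f k) :
    popNorm ι ell1Norm ell1Norm (diagElem (fun k => rankOneFin (f k) (f k)) A) = A.card := by
  set S := {r : ℝ | ∃ (n : ℕ) (a b : Fin n → (L →L[ℂ] L)) (u : Fin n → Amp L ell1)
      (v : Fin n → Amp L ell1),
    diagElem (fun k => rankOneFin (f k) (f k)) A =
      ∑ k, bimul (a k) (b k) (ampDiamond ι ell1 ell1 (u k) (v k)) ∧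
    r = ∑ k, ‖a k‖ * ell1Norm (u k) * ell1Norm (v k) * ‖b k‖}
  have hlb : ∀ r ∈ S, (A.card : ℝ) ≤ r := by
    rintro r ⟨n, a, b, u, v, hU, rfl⟩
    exact card_le_popNorm_repr ι _ A (fun t ht => (norm_rankOneFin_self hf ht).ge) a b u v hU
  -- For the upper bound the one-term representation is used on each singleton, where its cost is at
  -- most `1² = 1`.
  have hsing (k : A) : Orthonormal ℂ fun j : ({(k : ℕ)} : Finset ℕ) => f j :=
    hf.comp (fun j : ({(k : ℕ)} : Finset ℕ) => ⟨j, (Finset.mem_singleton.1 j.2).symm ▸ k.2⟩)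
      fun i j _ => Subsingleton.elim i j
  let e := A.equivFin.symm
  let g : ℕ → L := fun k => vecDiamond ι (f k) (f k)
  let a : Fin A.card → (L →L[ℂ] L) := fun i => sumRankOne {(e i : ℕ)} f g
  let b : Fin A.card → (L →L[ℂ] L) := fun i => sumRankOne {(e i : ℕ)} g f
  let u : Fin A.card → Amp L ell1 := fun i =>
    ∑ k ∈ {(e i : ℕ)}, rankOneFin (f k) (f k) ⊗ₜ[ℂ] ell1Basis k
  have hmem : (∑ i, ‖a i‖ * ell1Norm (u i) * ell1Norm (u i) * ‖b i‖) ∈ S := by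
    refine ⟨A.card, a, b, u, u, ?_, rfl⟩
    have h : ∀ i, bimul (a i) (b i) (ampDiamond ι ell1 ell1 (u i) (u i)) =
        rankOneFin (f (e i)) (f (e i)) ⊗ₜ[ℂ] (ell1Basis (e i) ⊗ₜ[ℂ] ell1Basis (e i)) := by
      intro i
      rw [← diagElem_eq_bimul_ampDiamond ι {(e i : ℕ)} (hsing (e i)), diagElem,
        Finset.sum_singleton]
    simp only [h]
    rw [e.sum_comp fun k : A =>
      rankOneFin (f k) (f k) ⊗ₜ[ℂ] (ell1Basis (k : ℕ) ⊗ₜ[ℂ] ell1Basis (k : ℕ)), diagElem,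
      Finset.sum_coe_sort A fun k =>
        rankOneFin (f k) (f k) ⊗ₜ[ℂ] (ell1Basis k ⊗ₜ[ℂ] ell1Basis k)]
  refine le_antisymm ((csInf_le ⟨_, hlb⟩ hmem).trans ?_) (le_csInf ⟨_, hmem⟩ hlb)
  calc _ ≤ ∑ _i : Fin A.card, (1 : ℝ) := Finset.sum_le_sum fun i _ => by
        have h := norm_mul_card_le (g := g) (hsing (e i)) (orthonormal_vecDiamond ι (hsing (e i)))
        rwa [Finset.card_singleton, Nat.cast_one, one_pow] at h
    _ = A.card := by simp

/-! ### Families of mutually orthogonal rank one projections -/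

/-- Applying `P_j P_k = 0` to `f_k` gives `⟨f_j, f_k⟩ f_j = 0` with `f_j ≠ 0`. Outside `A` the
values of `f` are arbitrary, which is why orthonormality is stated over the subtype. -/
theorem exists_orthonormal_of_projections {A : Finset ℕ} {P : ℕ → finiteRank L}
    (hP : ∀ k ∈ A, IsStarProjection (P k : L →L[ℂ] L) ∧
      Module.finrank ℂ (LinearMap.range ((P k : L →L[ℂ] L) : L →ₗ[ℂ] L)) = 1)
    (hPP : ∀ j ∈ A, ∀ k ∈ A, j ≠ k → (P j : L →L[ℂ] L) * (P k : L →L[ℂ] L) = 0) :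
    ∃ f : ℕ → L, (Orthonormal ℂ fun k : A => f k) ∧
      ∀ k ∈ A, P k = rankOneFin (f k) (f k) := by
  choose! f hf hPf using fun k hk => eq_rankOne_of_finrank_range_eq_one (hP k hk).1 (hP k hk).2
  refine ⟨f, ⟨fun k => hf k k.2, fun j k hjk => ?_⟩, fun k hk => Subtype.ext (hPf k hk)⟩
  have h := hPP j j.2 k k.2 (fun h => hjk (Subtype.ext h))
  rw [hPf j j.2, hPf k k.2] at h
  have hfk : inner ℂ (f k) (f k) = (1 : ℂ) := by
    rw [inner_self_eq_norm_sq_to_K, hf k k.2]; simp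
  have h1 := congrArg (fun T : L →L[ℂ] L => T (f k)) h
  simp only [mul_apply_eq_comp, InnerProductSpace.rankOne_apply, hfk, one_smul,
    zero_apply] at h1
  refine (smul_eq_zero.1 h1).resolve_right fun h0 => ?_
  simpa [h0] using hf j j.2

theorem norm_projection_diagElem (ι : UniformSpace.Completion (L ⊗[ℂ] L) ≃ₗᵢ[ℂ] L)
    {A : Finset ℕ} {P : ℕ → finiteRank L}
    (hP : ∀ k ∈ A, IsStarProjection (P k : L →L[ℂ] L) ∧
      Module.finrank ℂ (LinearMap.range ((P k : L →L[ℂ] L) : L →ₗ[ℂ] L)) = 1)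
    (hPP : ∀ j ∈ A, ∀ k ∈ A, j ≠ k → (P j : L →L[ℂ] L) * (P k : L →L[ℂ] L) = 0) :
    popNorm ι ell1Norm ell1Norm (diagElem P A) = A.card ∧
      opNorm ι ell1Norm ell1Norm (diagElem P A) = (A.card : ℝ) ^ 2 := by
  obtain ⟨f, hf, hPf⟩ := exists_orthonormal_of_projections hP hPP
  rw [diagElem_congr hPf]
  exact ⟨popNorm_diagElem ι A hf, opNorm_diagElem ι A hf⟩

end ProtoQuantum
end

theorem proposition8p1
    {L : Type*} [NormedAddCommGroup L] [InnerProductSpace ℂ L] [CompleteSpace L]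
    [TopologicalSpace.SeparableSpace L] (hL : ¬ FiniteDimensional ℂ L)
    (ι : UniformSpace.Completion (L ⊗[ℂ] L) ≃ₗᵢ[ℂ] L) :
    (ProtoQuantum.IsPQNorm (ProtoQuantum.ell1Norm (L := L)) ∧
      ¬ ProtoQuantum.IsQNorm (ProtoQuantum.ell1Norm (L := L))) ∧
    (∀ (n : ℕ) (P : ℕ → ProtoQuantum.finiteRank L),
      (∀ k ∈ Finset.Icc 1 n, IsStarProjection (P k : L →L[ℂ] L) ∧
        Module.finrank ℂ (LinearMap.range ((P k : L →L[ℂ] L) : L →ₗ[ℂ] L)) = 1) →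
      (∀ j ∈ Finset.Icc 1 n, ∀ k ∈ Finset.Icc 1 n, j ≠ k →
        (P j : L →L[ℂ] L) * (P k : L →L[ℂ] L) = 0) →
      ProtoQuantum.popNorm ι ProtoQuantum.ell1Norm ProtoQuantum.ell1Norm
          (ProtoQuantum.V P n) = n ∧
        ProtoQuantum.opNorm ι ProtoQuantum.ell1Norm ProtoQuantum.ell1Norm
          (ProtoQuantum.V P n) = (n : ℝ) ^ 2 ∧
        ∀ m : ℕ, 1 ≤ m → m < n →
          ProtoQuantum.opNorm ι ProtoQuantum.ell1Norm ProtoQuantum.ell1Norm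
              (ProtoQuantum.V P n - ProtoQuantum.V P m) = ((n : ℝ) - m) ^ 2 ∧
          ProtoQuantum.opNorm ι ProtoQuantum.ell1Norm ProtoQuantum.ell1Norm
              (ProtoQuantum.V P m) +
            ProtoQuantum.opNorm ι ProtoQuantum.ell1Norm ProtoQuantum.ell1Norm
              (ProtoQuantum.V P n - ProtoQuantum.V P m) <
            ProtoQuantum.opNorm ι ProtoQuantum.ell1Norm ProtoQuantum.ell1Norm
              (ProtoQuantum.V P n)) ∧
    ¬ ∃ N : Seminorm ℂ (ProtoQuantum.Amp L (ProtoQuantum.ell1 ⊗[ℂ] ProtoQuantum.ell1)),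
      ∀ U, N U = ProtoQuantum.opNorm ι ProtoQuantum.ell1Norm ProtoQuantum.ell1Norm U := by
  open ProtoQuantum in
  have main : ∀ (n : ℕ) (P : ℕ → finiteRank L),
      (∀ k ∈ Finset.Icc 1 n, IsStarProjection (P k : L →L[ℂ] L) ∧
        Module.finrank ℂ (LinearMap.range ((P k : L →L[ℂ] L) : L →ₗ[ℂ] L)) = 1) →
      (∀ j ∈ Finset.Icc 1 n, ∀ k ∈ Finset.Icc 1 n, j ≠ k →
        (P j : L →L[ℂ] L) * (P k : L →L[ℂ] L) = 0) →
      popNorm ι ell1Norm ell1Norm (V P n) = n ∧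
        opNorm ι ell1Norm ell1Norm (V P n) = (n : ℝ) ^ 2 ∧
        ∀ m : ℕ, 1 ≤ m → m < n →
          opNorm ι ell1Norm ell1Norm (V P n - V P m) = ((n : ℝ) - m) ^ 2 ∧
          opNorm ι ell1Norm ell1Norm (V P m) + opNorm ι ell1Norm ell1Norm (V P n - V P m) <
            opNorm ι ell1Norm ell1Norm (V P n) := by
    intro n P hP hPP
    -- Both `V_m` and `V_n - V_m` are diagonal sums over subsets of `{1, …, n}`, so one statement
    -- covers them.
    have hsub : ∀ A ⊆ Finset.Icc 1 n,
        popNorm ι ell1Norm ell1Norm (diagElem P A) = A.card ∧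
          opNorm ι ell1Norm ell1Norm (diagElem P A) = (A.card : ℝ) ^ 2 := fun A hA =>
      norm_projection_diagElem ι (fun k hk => hP k (hA hk))
        fun j hj k hk => hPP j (hA hj) k (hA hk)
    have hV : ∀ m ≤ n, popNorm ι ell1Norm ell1Norm (V P m) = m ∧
        opNorm ι ell1Norm ell1Norm (V P m) = (m : ℝ) ^ 2 := fun m hm => by
      have h := hsub (Finset.Icc 1 m) (Finset.Icc_subset_Icc_right hm)
      rwa [Nat.card_Icc, Nat.add_sub_cancel] at h
    refine ⟨(hV n le_rfl).1, (hV n le_rfl).2, fun m hm hmn => ?_⟩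
    have hdiff : opNorm ι ell1Norm ell1Norm (V P n - V P m) = ((n : ℝ) - m) ^ 2 := by
      rw [V_sub_V P hmn.le, (hsub _ fun k hk => ?_).2, Nat.card_Ioc, Nat.cast_sub hmn.le]
      rw [Finset.mem_Ioc] at hk
      exact Finset.mem_Icc.2 ⟨by omega, hk.2⟩
    refine ⟨hdiff, ?_⟩
    rw [hdiff, (hV n le_rfl).2, (hV m hmn.le).2]
    have h1 : (1 : ℝ) ≤ m := by exact_mod_cast hm
    have h2 : (m : ℝ) < n := by exact_mod_cast hmn
    -- The gap is `n² - m² - (n - m)² = 2m(n - m)`, positive because `1 ≤ m < n`.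
    nlinarith
  refine ⟨⟨ProtoQuantum.isPQNorm_ell1Norm, ProtoQuantum.not_isQNorm_ell1Norm hL⟩, main, ?_⟩
  rintro ⟨N, hN⟩
  obtain ⟨f, g, hf, hg, hfg⟩ := ProtoQuantum.exists_orthonormal_of_not_finiteDimensional hL
  -- Two orthogonal projections suffice: with `n = 2` and `m = 1`, only the indices 1 and 2 matter.
  let h : ℕ → L := fun k => if k = 1 then f else g
  have hh : ∀ k, ‖h k‖ = 1 := fun k => by
    simp only [h]
    split_ifs
    exacts [hf, hg]
  have hgf : inner ℂ g f = 0 := inner_eq_zero_symm.1 hfg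
  obtain ⟨-, -, hlt⟩ := main 2 (fun k => ProtoQuantum.rankOneFin (h k) (h k))
    (fun k _ => ⟨InnerProductSpace.isStarProjection_rankOne_self (hh k),
      ProtoQuantum.finrank_range_rankOne (hh k)⟩)
    (fun j hj k hk hjk => by
      have hort : inner ℂ (h j) (h k) = 0 := by
        rw [Finset.mem_Icc] at hj hk
        simp only [h]
        split_ifs
        · omega
        · exact hfg
        · exact hgf
        · omega
      ext x
      simp [hort])
  have hlt' := (hlt 1 le_rfl one_lt_two).2
  rw [← hN, ← hN, ← hN] at hlt'
  -- A seminorm would be subadditive on `V_2 = V_1 + (V_2 - V_1)`, against the strict inequality.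
  refine hlt'.not_ge ((le_of_eq ?_).trans (map_add_le_add N _ _))
  rw [ProtoQuantum.V_add_sub_cancel]
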